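/- Conventions. A map $f\colon U\to F$ from an open subset $U$ of a real locally convex space $E$ to a real locally convex space $F$ is called real analytic if it extends to a holomorphic map from an open neighbourhood of $U$ in the complexification $E_{\mathbb C}=E\times E$ to $F_{\mathbb C}$; here a map between complex locally convex spaces, defined on an open set, is holomorphic if it is continuous and all its iterated (complex) directional derivatives exist and are jointly continuous in the point and the directions (Keller's $C^\infty_{\mathbb C}$). Real analytic manifolds modelled on Hausdorff locally convex spaces and real analytic maps between them are defined through charts as usual. A real analytic Lie group is a group with a real analytic manifold structure for which multiplication and inversion are real analytic. Let $S^1\subseteq\mathbb C$ be the unit circle with its standard real analytic structure, and let $E=C^\omega(S^1,\mathbb R)$ with the subspace topology of $C^\omega(S^1,\mathbb C)\cong\varinjlim_U \mathrm{Hol}(U,\mathbb C)$, the locally convex inductive limit over the open neighbourhoods $U$ of $S^1$ in $\mathbb C$, each $\mathrm{Hol}(U,\mathbb C)$ carrying the compact-open topology. The set $C^\omega(S^1,S^1)$ is a real analytic manifold modelled on $E$ with the atlas consisting of the charts $$\Phi_f\colon\{\gamma : \gamma(z)\neq -f(z)\ \text{for all } z\}\to\{\eta\in E : |\eta(z)|<\pi\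 \text{for all } z\},\qquad \Phi_f(\gamma)(z)=\arg\bigl(\gamma(z)/f(z)\bigr),$$ $f\in C^\omega(S^1,S^1)$, where $\arg$ is the principal argument, and with the identification topology of this atlas. The group $\mathrm{Diff}^\omega(S^1)$ of real analytic diffeomorphisms of $S^1$ is an open submanifold. Theorem C. The group multiplication (composition) $\mathrm{Diff}^\omega(S^1)\times\mathrm{Diff}^\omega(S^1)\to\mathrm{Diff}^\omega(S^1)$ is not real analytic. Hence $\mathrm{Diff}^\omega(S^1)$ with this manifold structure is not a real analytic Lie group. -/

import Mathlib

open Set Filter Topology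
open scoped Manifold ContDiff

noncomputable section

namespace AnalyticDiff

/-! ### Calculus in locally convex spaces -/

section Calculus

/-- Keller's `C^∞`-maps over `𝕜` on an open set `U`: the function is continuous, and all iterated
directional derivatives `d k x (y₁, …, yₖ) = (D_{yₖ} ⋯ D_{y₁} f) x` exist and are continuous on
`U × E^k`. -/
def IsKellerSmoothOn (𝕜 : Type*) [NontriviallyNormedField 𝕜]
    {E F : Type*} [AddCommGroup E] [Module 𝕜 E] [TopologicalSpace E]
    [AddCommGroup F] [Module 𝕜 F] [TopologicalSpace F] (f : E → F) (U : Set E) : Prop :=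
  ∃ d : (k : ℕ) → E → (Fin k → E) → F,
    (∀ x ∈ U, ∀ y, d 0 x y = f x) ∧
    (∀ k, ContinuousOn (fun p : E × (Fin k → E) => d k p.1 p.2) (U ×ˢ univ)) ∧
    ∀ k, ∀ x ∈ U, ∀ (y : Fin k → E) (v : E),
      Tendsto (fun t : 𝕜 => t⁻¹ • (d k (x + t • v) y - d k x y)) (𝓝[≠] 0)
        (𝓝 (d (k + 1) x (Fin.snoc (α := fun _ => E) y v)))

/-- The complexification `E × E` of a real topological vector space; `(x, y)` stands for
`x + i y`. -/
def Complexification (E : Type*) : Type _ := E × E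

variable {E : Type*} [AddCommGroup E] [Module ℝ E] [TopologicalSpace E]

instance : AddCommGroup (Complexification E) := inferInstanceAs (AddCommGroup (E × E))

instance : TopologicalSpace (Complexification E) := inferInstanceAs (TopologicalSpace (E × E))

instance : Module ℂ (Complexification E) where
  smul z p := (z.re • p.1 - z.im • p.2, z.im • p.1 + z.re • p.2)
  one_smul p := by
    refine Prod.ext ?_ ?_
    · change (1 : ℂ).re • p.1 - (1 : ℂ).im • p.2 = p.1
      simp
    · change (1 : ℂ).im • p.1 + (1 : ℂ).re • p.2 = p.2
      simp
  mul_smul z w p := by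
    refine Prod.ext ?_ ?_
    · change (z * w).re • p.1 - (z * w).im • p.2
        = z.re • (w.re • p.1 - w.im • p.2) - z.im • (w.im • p.1 + w.re • p.2)
      simp only [Complex.mul_re, Complex.mul_im]
      module
    · change (z * w).im • p.1 + (z * w).re • p.2
        = z.im • (w.re • p.1 - w.im • p.2) + z.re • (w.im • p.1 + w.re • p.2)
      simp only [Complex.mul_re, Complex.mul_im]
      module
  smul_zero z := by
    refine Prod.ext ?_ ?_
    · change z.re • (0 : E) - z.im • (0 : E) = 0
      simp
    · change z.im • (0 : E) + z.re • (0 : E) = 0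
      simp
  smul_add z p q := by
    refine Prod.ext ?_ ?_
    · change z.re • (p.1 + q.1) - z.im • (p.2 + q.2)
        = (z.re • p.1 - z.im • p.2) + (z.re • q.1 - z.im • q.2)
      module
    · change z.im • (p.1 + q.1) + z.re • (p.2 + q.2)
        = (z.im • p.1 + z.re • p.2) + (z.im • q.1 + z.re • q.2)
      module
  add_smul z w p := by
    refine Prod.ext ?_ ?_
    · change (z + w).re • p.1 - (z + w).im • p.2
        = (z.re • p.1 - z.im • p.2) + (w.re • p.1 - w.im • p.2)
      simp only [Complex.add_re, Complex.add_im]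
      module
    · change (z + w).im • p.1 + (z + w).re • p.2
        = (z.im • p.1 + z.re • p.2) + (w.im • p.1 + w.re • p.2)
      simp only [Complex.add_re, Complex.add_im]
      module
  zero_smul p := by
    refine Prod.ext ?_ ?_
    · change (0 : ℂ).re • p.1 - (0 : ℂ).im • p.2 = 0
      simp
    · change (0 : ℂ).im • p.1 + (0 : ℂ).re • p.2 = 0
      simp

/-- The inclusion of `E` as the real part of its complexification. -/
def Complexification.ofReal (x : E) : Complexification E := ((x, 0) : E × E)

variable {F : Type*} [AddCommGroup F] [Module ℝ F] [TopologicalSpace F]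

/-- A map between real locally convex spaces is real analytic on the open set `U` if it extends
to a holomorphic (that is, Keller `C^∞` over `ℂ`) map on an open neighbourhood of `U` in the
complexification. -/
def IsRealAnalyticOn (f : E → F) (U : Set E) : Prop :=
  ∃ (V : Set (Complexification E)) (g : Complexification E → Complexification F),
    IsOpen V ∧ (∀ x ∈ U, Complexification.ofReal x ∈ V) ∧ IsKellerSmoothOn ℂ g V ∧
      ∀ x ∈ U, g (Complexification.ofReal x) = Complexification.ofReal (f x)

end Calculus

/-! ### Real analytic manifolds, maps and Lie groups modelled on locally convex spaces -/

section Manifolds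

variable (E F : Type*) [AddCommGroup E] [Module ℝ E] [TopologicalSpace E]
  [AddCommGroup F] [Module ℝ F] [TopologicalSpace F]

/-- The Hausdorff charted space `M`, modelled on the Hausdorff space `E`, is a real analytic
manifold: all changes of charts are real analytic. -/
structure IsRealAnalyticManifold (M : Type*) [TopologicalSpace M] [ChartedSpace E M] : Prop where
  t2_model : T2Space E
  t2 : T2Space M
  compatible : ∀ e ∈ atlas E M, ∀ e' ∈ atlas E M,
    IsRealAnalyticOn (e' ∘ e.symm) (e.target ∩ e.symm ⁻¹' e'.source)

/-- A map between real analytic manifolds is real analytic if it is continuous and all its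
representatives in charts are real analytic. -/
structure IsRealAnalyticMap {M N : Type*} [TopologicalSpace M] [ChartedSpace E M]
    [TopologicalSpace N] [ChartedSpace F N] (f : M → N) : Prop where
  continuous : Continuous f
  analytic : ∀ e ∈ atlas E M, ∀ e' ∈ atlas F N,
    IsRealAnalyticOn (e' ∘ f ∘ e.symm) (e.target ∩ e.symm ⁻¹' (f ⁻¹' e'.source))

/-- The product manifold structure (product charts), with model space `E × F`. -/
instance prodCharts (M N : Type*) [TopologicalSpace M] [ChartedSpace E M]
    [TopologicalSpace N] [ChartedSpace F N] : ChartedSpace (E × F) (M × N) :=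
  inferInstanceAs (ChartedSpace (ModelProd E F) (M × N))

/-- A real analytic Lie group: a group with a real analytic manifold structure for which
multiplication and inversion are real analytic. -/
structure IsRealAnalyticLieGroup (G : Type*) [Group G] [TopologicalSpace G]
    [ChartedSpace E G] : Prop where
  manifold : IsRealAnalyticManifold E G
  mul : IsRealAnalyticMap (E × E) E (fun p : G × G => p.1 * p.2)
  inv : IsRealAnalyticMap E E (fun g : G => g⁻¹)

end Manifolds

/-! ### The Silva space of real analytic functions on the circle -/

/-- The space of real analytic complex-valued functions on the circle, as a subspace of the space
of all functions. -/
def cwcSubmodule : Submodule ℂ (Circle → ℂ) where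
  carrier := {f | ContMDiff (𝓡 1) 𝓘(ℝ, ℂ) ω f}
  add_mem' {f g} hf hg := by
    have hf' : ContMDiff (𝓡 1) 𝓘(ℝ, ℂ) ω f := hf
    exact hf'.add hg
  zero_mem' := contMDiff_const
  smul_mem' c f hf := by
    have hf' : ContMDiff (𝓡 1) 𝓘(ℝ, ℂ) ω f := hf
    have h : ContDiff ℝ ω (fun z : ℂ => c * z) := contDiff_const.mul contDiff_id
    exact h.contMDiff.comp hf'

/-- The complex vector space of real analytic functions `Circle → ℂ`. Restriction to the circle
identifies the space of germs along the circle of holomorphic functions with this space. -/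
def CwC : Type := cwcSubmodule

instance : AddCommGroup CwC := inferInstanceAs (AddCommGroup cwcSubmodule)

instance : Module ℂ CwC := inferInstanceAs (Module ℂ cwcSubmodule)

/-- The function underlying an element of `CwC`. -/
def CwC.val (f : CwC) : Circle → ℂ := Subtype.val (p := fun f => f ∈ cwcSubmodule) f

/-- The element of `CwC` given by a real analytic function. -/
def CwC.mk (f : Circle → ℂ) (hf : ContMDiff (𝓡 1) 𝓘(ℝ, ℂ) ω f) : CwC :=
  (⟨f, hf⟩ : cwcSubmodule)

/-- Holomorphic functions on the open set `U ⊆ ℂ`; as a subspace of `C(U, ℂ)` it carries the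
compact-open topology. -/
def Hol (U : TopologicalSpace.Opens ℂ) : Submodule ℂ C(U, ℂ) where
  carrier := {f | ∃ F : ℂ → ℂ, DifferentiableOn ℂ F U ∧ ∀ z : U, F z = f z}
  add_mem' := by
    rintro f g ⟨F, hF, hf⟩ ⟨G, hG, hg⟩
    exact ⟨F + G, hF.add hG, fun z => by simp [hf, hg]⟩
  zero_mem' := ⟨0, differentiableOn_const 0, fun z => by simp⟩
  smul_mem' := by
    rintro c f ⟨F, hF, hf⟩
    exact ⟨c • F, hF.const_smul c, fun z => by simp [hf]⟩

attribute [local instance] finrank_real_complex_fact'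

lemma contMDiff_coeCircle : ContMDiff (𝓡 1) 𝓘(ℝ, ℂ) ω (fun z : Circle => (z : ℂ)) :=
  contMDiff_coe_sphere

lemma contMDiff_restrict {U : TopologicalSpace.Opens ℂ} (hU : ∀ z : Circle, (z : ℂ) ∈ U)
    {F : ℂ → ℂ} (hF : DifferentiableOn ℂ F U) :
    ContMDiff (𝓡 1) 𝓘(ℝ, ℂ) ω (fun z : Circle => F z) := by
  intro z
  have h1 : AnalyticAt ℂ F z := hF.analyticAt (U.isOpen.mem_nhds (hU z))
  have h2 : ContDiffAt ℝ ω F z := h1.contDiffAt.restrict_scalars ℝ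
  exact h2.contMDiffAt.comp z (contMDiff_coeCircle z)

/-- Restriction to the circle of functions that are holomorphic on a neighbourhood of it. -/
def resCircle (U : TopologicalSpace.Opens ℂ) (hU : ∀ z : Circle, (z : ℂ) ∈ U) :
    Hol U →ₗ[ℂ] CwC where
  toFun f := CwC.mk (fun z => (f : C(U, ℂ)) ⟨z, hU z⟩) <| by
    obtain ⟨F, hF, hf⟩ := f.2
    exact (contMDiff_restrict hU hF).congr fun z => (hf ⟨z, hU z⟩).symm
  map_add' _ _ := rfl
  map_smul' _ _ := rfl

/-- The locally convex inductive limit topology: the finest locally convex vector space topology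
for which the restriction maps `Hol U → CwC` are continuous, for all open neighbourhoods `U` of
the circle. -/
instance : TopologicalSpace CwC :=
  sInf {t : TopologicalSpace CwC |
    (∀ (U : TopologicalSpace.Opens ℂ) (hU : ∀ z : Circle, (z : ℂ) ∈ U),
      @Continuous _ _ _ t (resCircle U hU)) ∧
    @IsTopologicalAddGroup CwC t _ ∧ @ContinuousSMul ℂ CwC _ _ t ∧
    @LocallyConvexSpace ℝ CwC _ _ _ _ t}

instance : IsTopologicalAddGroup CwC := topologicalAddGroup_sInf fun _ h => h.2.1

instance : ContinuousSMul ℂ CwC := continuousSMul_sInf fun _ h => h.2.2.1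

instance : ContinuousSMul ℝ CwC := IsScalarTower.continuousSMul ℂ

instance : LocallyConvexSpace ℝ CwC := .sInf fun _ h => h.2.2.2

/-- The real vector space of real analytic functions `Circle → ℝ`. -/
abbrev CwR : Type := C^ω⟮𝓡 1, Circle; 𝓘(ℝ, ℝ), ℝ⟯

/-- The inclusion of the real-valued into the complex-valued analytic functions. -/
def CwR.toCwC : CwR →ₗ[ℝ] CwC where
  toFun f := CwC.mk (fun z => (f z : ℂ)) (Complex.ofRealCLM.contDiff.contMDiff.comp f.contMDiff)
  map_add' f g := Subtype.ext <| funext fun z => Complex.ofReal_add (f z) (g z)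
  map_smul' c f := Subtype.ext <| funext fun z => Complex.ofReal_mul c (f z)

/-- The subspace topology. -/
instance : TopologicalSpace CwR := TopologicalSpace.induced CwR.toCwC inferInstance

instance : IsTopologicalAddGroup CwR := topologicalAddGroup_induced CwR.toCwC

instance : ContinuousSMul ℝ CwR := continuousSMul_induced CwR.toCwC

instance : LocallyConvexSpace ℝ CwR := .induced CwR.toCwC

/-- A linear map from `CwC` to a normed space is continuous if its compositions with all the
restriction maps are. -/
lemma continuous_of_restrict {W : Type*} [NormedAddCommGroup W] [NormedSpace ℂ W]
    (T : CwC →ₗ[ℂ] W)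
    (h : ∀ (U : TopologicalSpace.Opens ℂ) (hU : ∀ z : Circle, (z : ℂ) ∈ U),
      Continuous fun f : Hol U => T (resCircle U hU f)) : Continuous T := by
  rw [continuous_iff_le_induced]
  refine sInf_le ⟨fun U hU => continuous_induced_rng.2 (h U hU), topologicalAddGroup_induced T,
    continuousSMul_induced T, ?_⟩
  exact .induced (T.restrictScalars ℝ)

lemma CwC.contMDiff (f : CwC) : ContMDiff (𝓡 1) 𝓘(ℝ, ℂ) ω f.val := f.2

/-- The inclusion into the continuous functions. -/
def toCont : CwC →ₗ[ℂ] C(Circle, ℂ) where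
  toFun f := ⟨f.val, f.contMDiff.continuous⟩
  map_add' _ _ := rfl
  map_smul' _ _ := rfl

lemma continuous_toCont : Continuous toCont := by
  refine continuous_of_restrict _ fun U hU => ?_
  let i : C(Circle, U) := ⟨fun z => ⟨z, hU z⟩, by fun_prop⟩
  exact (ContinuousMap.continuous_precomp i).comp continuous_subtype_val

lemma continuous_toCont_toCwC : Continuous fun η : CwR => toCont (CwR.toCwC η) :=
  continuous_toCont.comp continuous_induced_dom

lemma toCont_toCwC_apply (η : CwR) (z : Circle) : toCont (CwR.toCwC η) z = (η z : ℂ) := rfl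

instance : T2Space CwR := by
  refine T2Space.of_injective_continuous (f := fun η : CwR => toCont (CwR.toCwC η)) ?_
    continuous_toCont_toCwC
  intro η ξ h
  ext z
  have := DFunLike.congr_fun h z
  simpa [toCont_toCwC_apply] using this

lemma continuous_eval (z : Circle) : Continuous fun η : CwR => η z :=
  Complex.continuous_re.comp ((continuous_eval_const z).comp continuous_toCont_toCwC)

/-- The open set of functions with values in `(-π, π)`. -/
def chartTarget : Set CwR := {η | ∀ z, |η z| < Real.pi}

lemma isOpen_chartTarget : IsOpen chartTarget := by
  have : chartTarget = (fun η : CwR => toCont (CwR.toCwC η)) ⁻¹' Metric.ball 0 Real.pi := by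
    ext η
    simp [chartTarget, ContinuousMap.norm_lt_iff _ Real.pi_pos, toCont_toCwC_apply]
  rw [this]
  exact Metric.isOpen_ball.preimage continuous_toCont_toCwC

/-- The set `C^ω(S¹, S¹)`. -/
abbrev CwS : Type := C^ω⟮𝓡 1, Circle; 𝓡 1, Circle⟯

/-- The inverse of the canonical chart centred at `f`: the function `η` is sent to the map
`z ↦ f z * exp (i η z)`, given by the local addition `(z, r) ↦ z * exp (i r)` of the circle. -/
def param (f : CwS) (η : CwR) : CwS :=
  ⟨fun z => f z * Circle.exp (η z),
    f.contMDiff.mul (contMDiff_circleExp.comp η.contMDiff)⟩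

lemma param_apply (f : CwS) (η : CwR) (z : Circle) : param f η z = f z * Circle.exp (η z) := rfl

/-- The identification topology of the canonical atlas: the finest topology for which all the
inverses `param f : chartTarget → CwS` of the canonical charts are continuous. -/
instance : TopologicalSpace CwS :=
  ⨆ f : CwS, .coinduced (fun η : chartTarget => param f η) inferInstance

lemma isOpen_CwS_iff (V : Set CwS) :
    IsOpen V ↔ ∀ f : CwS, IsOpen {η | η ∈ chartTarget ∧ param f η ∈ V} := by
  rw [isOpen_iSup_iff]
  refine forall_congr' fun f => ?_
  rw [isOpen_coinduced, isOpen_chartTarget.isOpenEmbedding_subtypeVal.isOpen_iff_image_isOpen]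
  refine iff_of_eq (congrArg IsOpen ?_)
  ext η
  simp [and_comm]

lemma continuous_param (f : CwS) : ContinuousOn (param f) chartTarget := by
  rw [continuousOn_iff_continuous_domRestrict]
  exact continuous_iff_coinduced_le.2
    (le_iSup (fun f : CwS => TopologicalSpace.coinduced (fun η : chartTarget => param f η) _) f)

/-- The charts are related by translations. -/
lemma param_translate {f g : CwS} {σ τ : CwR} (h : param g σ = param f τ) (σ' : CwR) :
    param g σ' = param f (σ' + (τ - σ)) := by
  ext z
  have h1 := DFunLike.congr_fun h z
  simp only [param_apply] at h1 ⊢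
  have h2 : (σ' + (τ - σ)) z = σ' z - σ z + τ z := by
    change σ' z + (τ z - σ z) = _
    ring
  rw [h2, Circle.exp_add, mul_comm (Circle.exp (σ' z - σ z)), ← mul_assoc, ← h1, mul_assoc,
    ← Circle.exp_add]
  congr 3
  ring

lemma isOpen_param_image (f : CwS) {W : Set CwR} (hW : IsOpen W) : IsOpen (param f '' W) := by
  rw [isOpen_CwS_iff]
  intro g
  rw [isOpen_iff_mem_nhds]
  rintro σ ⟨hσ, τ, hτ, h⟩
  have hc : Continuous fun σ' : CwR => σ' + (τ - σ) := by fun_prop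
  have hm : (fun σ' : CwR => σ' + (τ - σ)) ⁻¹' W ∈ 𝓝 σ :=
    hc.continuousAt.preimage_mem_nhds (hW.mem_nhds (by simpa using hτ))
  filter_upwards [hm, isOpen_chartTarget.mem_nhds hσ] with σ' h1 h2
  exact ⟨h2, _, h1, (param_translate h.symm σ').symm⟩

lemma mem_slitPlane_circle {z : Circle} (h : (z : ℂ) ≠ -1) : (z : ℂ) ∈ Complex.slitPlane := by
  rw [Complex.mem_slitPlane_iff_arg]
  refine ⟨fun ha => h ?_, z.coe_ne_zero⟩
  have := Circle.exp_arg z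
  rw [ha] at this
  rw [← this]
  simp

lemma contMDiffAt_arg {z : Circle} (h : (z : ℂ) ≠ -1) :
    ContMDiffAt (𝓡 1) 𝓘(ℝ, ℝ) ω (fun w : Circle => Complex.arg w) z := by
  have h1 : ContDiffAt ℝ ω Complex.log (z : ℂ) :=
    (Complex.contDiffAt_log (mem_slitPlane_circle h)).restrict_scalars ℝ
  have h2 : ContDiffAt ℝ ω (fun w => (Complex.log w).im) (z : ℂ) :=
    Complex.imCLM.contDiff.contDiffAt.comp _ h1
  have h3 := h2.contMDiffAt.comp z (contMDiff_coeCircle z)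
  refine h3.congr_of_eventuallyEq (Eventually.of_forall fun w => ?_)
  exact (Complex.log_im _).symm

lemma div_ne_neg_one {a b : Circle} (h : (a : ℂ) ≠ -(b : ℂ)) : ((a / b : Circle) : ℂ) ≠ -1 := by
  rw [Circle.coe_div]
  intro h'
  rw [div_eq_iff b.coe_ne_zero] at h'
  exact h (by simpa using h')

/-- The function `z ↦ arg (γ z / f z)`, where `arg` is the principal argument. -/
def argDiv (f γ : CwS) (h : ∀ z, (γ z : ℂ) ≠ -(f z : ℂ)) : CwR :=
  ⟨fun z => Complex.arg (γ z / f z : Circle), fun z =>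
    (contMDiffAt_arg (div_ne_neg_one (h z))).comp z ((γ.contMDiff.div f.contMDiff) z)⟩

lemma exp_ne_neg_one {x : ℝ} (hx : |x| < Real.pi) : (Circle.exp x : ℂ) ≠ -1 := by
  intro h
  have h1 := Circle.arg_exp (neg_lt_of_abs_lt hx) (lt_of_abs_lt hx).le
  rw [h, Complex.arg_neg_one] at h1
  rw [← h1] at hx
  exact absurd hx (by rw [abs_of_pos Real.pi_pos]; exact lt_irrefl _)

lemma abs_arg_lt {z : Circle} (h : (z : ℂ) ≠ -1) : |Complex.arg z| < Real.pi := by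
  refine abs_lt.2 ⟨Complex.neg_pi_lt_arg _, lt_of_le_of_ne (Complex.arg_le_pi _) ?_⟩
  exact (Complex.mem_slitPlane_iff_arg.1 (mem_slitPlane_circle h)).1

/-- The domain `U_f` of the canonical chart centred at `f`: the set of all `γ` such that `γ z` and
`f z` are never antipodal. -/
def chartSource (f : CwS) : Set CwS := {γ | ∀ z, (γ z : ℂ) ≠ -(f z : ℂ)}

open Classical in
/-- The canonical chart `Φ_f : γ ↦ arg (γ / f)`, extended by zero outside its domain. -/
def chartFun (f γ : CwS) : CwR :=
  if h : ∀ z, (γ z : ℂ) ≠ -(f z : ℂ) then argDiv f γ h else 0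

lemma chartFun_apply {f γ : CwS} (h : γ ∈ chartSource f) (z : Circle) :
    chartFun f γ z = Complex.arg (γ z / f z : Circle) := by
  have h' : ∀ z, (γ z : ℂ) ≠ -(f z : ℂ) := h
  unfold chartFun
  rw [dif_pos h']
  rfl

lemma chartFun_mem {f γ : CwS} (h : γ ∈ chartSource f) : chartFun f γ ∈ chartTarget := by
  intro z
  rw [chartFun_apply h]
  exact abs_arg_lt (div_ne_neg_one (h z))

lemma param_mem (f : CwS) {η : CwR} (hη : η ∈ chartTarget) : param f η ∈ chartSource f := by
  intro z h
  rw [param_apply, Circle.coe_mul] at h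
  have h2 : (f z : ℂ) * Circle.exp (η z) = f z * (-1) := by rw [h]; ring
  exact exp_ne_neg_one (hη z) (mul_left_cancel₀ (f z).coe_ne_zero h2)

lemma param_chartFun {f γ : CwS} (h : γ ∈ chartSource f) : param f (chartFun f γ) = γ := by
  ext z
  rw [param_apply, chartFun_apply h, Circle.exp_arg]
  simp

lemma chartFun_param (f : CwS) {η : CwR} (hη : η ∈ chartTarget) :
    chartFun f (param f η) = η := by
  ext z
  rw [chartFun_apply (param_mem f hη), param_apply, mul_div_cancel_left]
  exact Circle.arg_exp (neg_lt_of_abs_lt (hη z)) (lt_of_abs_lt (hη z)).le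

/-- The canonical chart `Φ_f : U_f → chartTarget` of `C^ω(S¹, S¹)` centred at `f`. -/
def chartCwS (f : CwS) : OpenPartialHomeomorph CwS CwR where
  toFun := chartFun f
  invFun := param f
  source := chartSource f
  target := chartTarget
  map_source' _ h := chartFun_mem h
  map_target' _ h := param_mem f h
  left_inv' _ h := param_chartFun h
  right_inv' _ h := chartFun_param f h
  open_source := by
    convert isOpen_param_image f isOpen_chartTarget
    exact Subset.antisymm (fun γ h => ⟨_, chartFun_mem h, param_chartFun h⟩)
      (by rintro _ ⟨η, h, rfl⟩; exact param_mem f h)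
  open_target := isOpen_chartTarget
  continuousOn_toFun := by
    refine continuousOn_iff'.2 fun W hW =>
      ⟨_, isOpen_param_image f (hW.inter isOpen_chartTarget), ?_⟩
    ext γ
    constructor
    · rintro ⟨h1, h2⟩
      exact ⟨⟨_, ⟨h1, chartFun_mem h2⟩, param_chartFun h2⟩, h2⟩
    · rintro ⟨⟨η, ⟨h1, h2⟩, rfl⟩, h⟩
      exact ⟨by rwa [mem_preimage, chartFun_param f h2], h⟩
  continuousOn_invFun := continuous_param f

lemma self_mem_chartSource (f : CwS) : f ∈ chartSource f := by
  intro z h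
  have h2 : (2 : ℂ) * f z = 0 := by linear_combination h
  rcases mul_eq_zero.1 h2 with h3 | h3
  · norm_num at h3
  · exact (f z).coe_ne_zero h3

/-- The canonical atlas of `C^ω(S¹, S¹)`. -/
instance : ChartedSpace CwR CwS where
  atlas := range chartCwS
  chartAt := chartCwS
  mem_chart_source := self_mem_chartSource
  chart_mem_atlas := mem_range_self

lemma continuous_CwS_eval (z : Circle) : Continuous fun γ : CwS => γ z := by
  refine continuous_iSup_dom.2 fun f => continuous_coinduced_dom.2 ?_
  change Continuous fun η : chartTarget => f z * Circle.exp ((η : CwR) z)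
  have := (continuous_eval z).comp (continuous_subtype_val (p := (· ∈ chartTarget)))
  exact continuous_const.mul (Circle.exp.continuous.comp this)

instance : T2Space CwS :=
  T2Space.of_injective_continuous (f := fun (γ : CwS) (z : Circle) => γ z)
    DFunLike.coe_injective (continuous_pi continuous_CwS_eval)

/-! ### The group of real analytic diffeomorphisms of the circle -/

/-- The set `Diff^ω(S¹)` of real analytic diffeomorphisms of the circle. -/
abbrev DiffS : Type := Circle ≃ₘ^ω⟮𝓡 1, 𝓡 1⟯ Circle

/-- The group structure given by composition: `(f * g) z = f (g z)`. -/
instance : Group DiffS where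
  mul f g := g.trans f
  one := Diffeomorph.refl _ _ _
  inv f := f.symm
  mul_assoc _ _ _ := rfl
  one_mul _ := rfl
  mul_one _ := rfl
  inv_mul_cancel f := Diffeomorph.ext fun z => f.symm_apply_apply z

/-- The inclusion `Diff^ω(S¹) → C^ω(S¹, S¹)`. -/
def DiffS.toCwS (f : DiffS) : CwS := f.toContMDiffMap

/-- The topology as a subspace of `C^ω(S¹, S¹)`. -/
instance : TopologicalSpace DiffS := TopologicalSpace.induced DiffS.toCwS inferInstance

lemma toCwS_injective : Function.Injective DiffS.toCwS := fun _ _ h =>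
  Diffeomorph.ext fun z => DFunLike.congr_fun h z

lemma contDiff_circleExp_comp {g : Circle → ℂ} (hg : ContMDiff (𝓡 1) 𝓘(ℝ, ℂ) ω g) :
    ContDiff ℝ ω fun t : ℝ => g (Circle.exp t) :=
  (hg.comp contMDiff_circleExp).contDiff

lemma contDiff_lift (η : CwR) : ContDiff ℝ ω fun t : ℝ => η (Circle.exp t) :=
  (η.contMDiff.comp contMDiff_circleExp).contDiff

/-- The angular derivative of `f ∘ h` on `[0, 2π]`. -/
def angDeriv (h : CwS) : CwC →ₗ[ℂ] C(Icc (0 : ℝ) (2 * Real.pi), ℂ) where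
  toFun f := ⟨fun t => deriv (fun s : ℝ => f.val (h (Circle.exp s))) t,
    ((contDiff_circleExp_comp (f.contMDiff.comp h.contMDiff)).continuous_deriv
      (by simp)).comp continuous_subtype_val⟩
  map_add' f g := by
    ext t
    have hf := (contDiff_circleExp_comp (f.contMDiff.comp h.contMDiff)).differentiable
      (by simp) t
    have hg := (contDiff_circleExp_comp (g.contMDiff.comp h.contMDiff)).differentiable
      (by simp) t
    exact deriv_add hf hg
  map_smul' c f := by
    ext t
    have hf := (contDiff_circleExp_comp (f.contMDiff.comp h.contMDiff)).differentiable
      (by simp) t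
    exact deriv_const_mul c hf

lemma continuous_angDeriv (h : CwS) : Continuous (angDeriv h) := by
  refine continuous_of_restrict _ fun U hU => ?_
  let c : ℝ → ℂ := fun s => h (Circle.exp s)
  have hc : ContDiff ℝ ω c := contDiff_circleExp_comp (contMDiff_coeCircle.comp h.contMDiff)
  let K := Icc (0 : ℝ) (2 * Real.pi)
  choose G hG hGf using fun f : Hol U => f.2
  have : WeaklyLocallyCompactSpace U := by
    have : LocallyCompactSpace U := U.isOpen.locallyCompactSpace
    infer_instance
  have hcU : ∀ t, c t ∈ (U : Set ℂ) := fun t => hU _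
  have hcont : ∀ f, Continuous fun t : K => deriv (G f) (c t) := fun f => by
    have h1 : ContinuousOn (deriv (G f)) U := ((hG f).deriv U.isOpen).continuousOn
    exact h1.comp_continuous (hc.continuous.comp continuous_subtype_val) fun t => hcU t
  let P : Hol U → C(K, ℂ) := fun f => ⟨fun t => deriv (G f) (c t), hcont f⟩
  let c' : C(K, ℂ) := ⟨fun t => deriv c t,
    (hc.continuous_deriv (by simp)).comp continuous_subtype_val⟩
  have hP : Continuous P := by
    rw [continuous_iff_continuousAt]
    intro f₀
    rw [ContinuousAt, ContinuousMap.tendsto_iff_tendstoUniformly]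
    have h1 : TendstoLocallyUniformly (fun (f : Hol U) (z : U) => (f : C(U, ℂ)) z)
        (f₀ : C(U, ℂ)) (𝓝 f₀) :=
      ContinuousMap.tendsto_iff_tendstoLocallyUniformly.1
        (continuous_subtype_val.continuousAt (x := f₀))
    have h2 : TendstoLocallyUniformlyOn G (G f₀) (𝓝 f₀) (U : Set ℂ) := by
      rw [tendstoLocallyUniformlyOn_iff_tendstoLocallyUniformly_comp_coe]
      have e : ∀ f : Hol U, (fun z : U => G f z) = fun z => (f : C(U, ℂ)) z :=
        fun f => funext (hGf f)
      change TendstoLocallyUniformly (fun (f : Hol U) (z : U) => G f z) (fun z : U => G f₀ z) _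
      rw [e f₀, funext e]
      exact h1
    have h3 := h2.deriv (Eventually.of_forall hG) U.isOpen
    have h4 := (tendstoLocallyUniformlyOn_iff_forall_isCompact U.isOpen).1 h3 (c '' K)
      (by rintro _ ⟨t, -, rfl⟩; exact hcU t) (isCompact_Icc.image hc.continuous)
    intro u hu
    filter_upwards [h4 u hu] with f hf t
    exact hf (c t) ⟨t, t.2, rfl⟩
  have : (fun f : Hol U => angDeriv h (resCircle U hU f)) = fun f => P f * c' := by
    funext f
    ext t
    have h1 : HasDerivAt (G f) (deriv (G f) (c t)) (c t) :=
      ((hG f).differentiableAt (U.isOpen.mem_nhds (hcU t))).hasDerivAt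
    have h2 : HasDerivAt c (deriv c t) t := (hc.differentiable (by simp) t).hasDerivAt
    have h3 := (h1.comp (t : ℝ) h2).deriv
    refine Eq.trans (congrArg (fun g => deriv g (t : ℝ)) (funext fun s => ?_)) h3
    exact (hGf f ⟨c s, hcU s⟩).symm
  rw [this]
  exact hP.mul continuous_const

/-- Functions with small angular derivative of `η ∘ h` form a neighbourhood of zero. -/
lemma isOpen_small_deriv (h : CwS) :
    IsOpen {η : CwR | ∀ t : ℝ, |deriv (fun s : ℝ => η (h (Circle.exp s))) t| < 1} := by
  have key : {η : CwR | ∀ t : ℝ, |deriv (fun s : ℝ => η (h (Circle.exp s))) t| < 1}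
      = (fun η : CwR => angDeriv h (CwR.toCwC η)) ⁻¹' Metric.ball 0 1 := by
    ext η
    rw [mem_preimage, mem_ball_zero_iff, ContinuousMap.norm_lt_iff _ one_pos, mem_ofPred_eq]
    have hd : ∀ t, HasDerivAt (fun s : ℝ => η (h (Circle.exp s)))
        (deriv (fun s : ℝ => η (h (Circle.exp s))) t) t := fun t =>
      (((η.contMDiff.comp (h.contMDiff.comp contMDiff_circleExp)).contDiff.differentiable
        (by simp)) t).hasDerivAt
    have e : ∀ t : Icc (0 : ℝ) (2 * Real.pi), ‖angDeriv h (CwR.toCwC η) t‖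
        = |deriv (fun s : ℝ => η (h (Circle.exp s))) t| := fun t => by
      have := (hd t).ofReal_comp.deriv
      rw [← Real.norm_eq_abs, ← Complex.norm_real, ← this]
      rfl
    have hper : Function.Periodic (deriv (fun s : ℝ => η (h (Circle.exp s)))) (2 * Real.pi) := by
      intro t
      rw [← deriv_comp_add_const]
      simp only [Circle.exp_add, Circle.exp_two_pi, mul_one]
    constructor
    · intro H t
      rw [e]
      exact H t
    · intro H t
      obtain ⟨s, hs, hst⟩ := hper.exists_mem_Ico₀ Real.two_pi_pos t
      rw [hst]
      have := H ⟨s, hs.1, hs.2.le⟩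
      rwa [e] at this
  rw [key]
  exact Metric.isOpen_ball.preimage ((continuous_angDeriv h).comp continuous_induced_dom)

/-- A small perturbation of the identity is a diffeomorphism. -/
lemma exists_diffeo (ξ : CwR) (hξ : ∀ t : ℝ, |deriv (fun s : ℝ => ξ (Circle.exp s)) t| < 1) :
    ∃ Φ : DiffS, ∀ z, Φ z = z * Circle.exp (ξ z) := by
  have hsm := contDiff_lift ξ
  let F : ℝ → ℝ := fun t => t + ξ (Circle.exp t)
  have hF : ContDiff ℝ ω F := contDiff_id.add hsm
  have hF' : ∀ t, HasDerivAt F (1 + deriv (fun s : ℝ => ξ (Circle.exp s)) t) t := fun t =>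
    (hasDerivAt_id t).add (hsm.differentiable (by simp) t).hasDerivAt
  have hpos : ∀ t, 0 < 1 + deriv (fun s : ℝ => ξ (Circle.exp s)) t := fun t => by
    linarith [neg_lt_of_abs_lt (hξ t)]
  have hmono : StrictMono F := strictMono_of_deriv_pos fun t => by
    rw [(hF' t).deriv]
    exact hpos t
  obtain ⟨C, hC⟩ : ∃ C, ∀ z, |ξ z| ≤ C := by
    obtain ⟨z, -, hz⟩ := isCompact_univ.exists_isMaxOn (univ_nonempty (α := Circle))
      (ξ.contMDiff.continuous.abs.continuousOn)
    exact ⟨_, fun w => hz (mem_univ w)⟩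
  have hsurj : Function.Surjective F := by
    refine hF.continuous.surjective ?_ ?_
    · refine tendsto_atTop_mono (fun t => ?_) (tendsto_atTop_add_const_right _ (-C) tendsto_id)
      have := neg_le_of_abs_le (hC (Circle.exp t))
      exact add_le_add_right this _
    · refine tendsto_atBot_mono (fun t => ?_) (tendsto_atBot_add_const_right _ C tendsto_id)
      exact add_le_add_right (le_of_abs_le (hC (Circle.exp t))) _
  have hshift : ∀ (t : ℝ) (m : ℤ), F (t + m * (2 * Real.pi)) = F t + m * (2 * Real.pi) := by
    intro t m
    have : Circle.exp (t + m * (2 * Real.pi)) = Circle.exp t := by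
      rw [Circle.exp_eq_exp]
      exact ⟨m, by ring⟩
    simp only [F, this]
    ring
  let H : ℝ ≃ₜ ℝ := (hmono.orderIsoOfSurjective F hsurj).toHomeomorph
  have hHF : ∀ t, H t = F t := fun _ => rfl
  have hG : ContDiff ℝ ω H.symm :=
    H.contDiff_symm_deriv (fun t => (hpos t).ne') hF' hF
  let γ : Circle → Circle := fun z => z * Circle.exp (ξ z)
  have hγ : ContMDiff (𝓡 1) (𝓡 1) ω γ := contMDiff_id.mul (contMDiff_circleExp.comp ξ.contMDiff)
  have hγF : ∀ t, γ (Circle.exp t) = Circle.exp (F t) := fun t => (Circle.exp_add _ _).symm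
  have hinj : Function.Injective γ := by
    intro z w h
    obtain ⟨s, rfl⟩ := Circle.exp_surjective z
    obtain ⟨t, rfl⟩ := Circle.exp_surjective w
    rw [hγF, hγF, Circle.exp_eq_exp] at h
    obtain ⟨m, hm⟩ := h
    rw [← hshift] at hm
    rw [hmono.injective hm, Circle.exp_eq_exp]
    exact ⟨m, by ring⟩
  have hsur : Function.Surjective γ := by
    intro w
    obtain ⟨t, rfl⟩ := Circle.exp_surjective w
    obtain ⟨s, rfl⟩ := hsurj t
    exact ⟨_, hγF s⟩
  let e := Equiv.ofBijective γ ⟨hinj, hsur⟩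
  have he : ∀ y : ℝ, e.symm (Circle.exp y) = Circle.exp (H.symm y) := by
    intro y
    rw [Equiv.symm_apply_eq]
    change _ = γ _
    rw [hγF, ← hHF, H.apply_symm_apply]
  refine ⟨⟨e, hγ, ?_⟩, fun z => rfl⟩
  intro w
  obtain ⟨y, rfl⟩ := Circle.exp_surjective w
  have h0 : ∀ w : Circle,
      e.symm w = Circle.exp (H.symm (y + Complex.arg (w / Circle.exp y : Circle))) := by
    intro w
    rw [← he, Circle.exp_add, Circle.exp_arg, mul_div_cancel]
  have h1 : ContMDiffAt (𝓡 1) 𝓘(ℝ, ℝ) ω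
      (fun w : Circle => Complex.arg (w / Circle.exp y : Circle)) (Circle.exp y) := by
    refine ContMDiffAt.comp (Circle.exp y)
      (g := fun w : Circle => Complex.arg w) (f := fun w : Circle => w / Circle.exp y)
      (contMDiffAt_arg ?_) (contMDiff_id.div contMDiff_const _)
    rw [div_self']
    norm_num
  have h2 : ContDiff ℝ ω fun x : ℝ => H.symm (y + x) := hG.comp (contDiff_const.add contDiff_id)
  have h3 := (contMDiff_circleExp (m := ω)).contMDiffAt.comp (Circle.exp y)
    (h2.contMDiff.contMDiffAt.comp (Circle.exp y) h1)
  exact h3.congr_of_eventuallyEq (Eventually.of_forall h0)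

/-- The diffeomorphisms form an open subset of `C^ω(S¹, S¹)`. -/
lemma isOpen_range_toCwS : IsOpen (range DiffS.toCwS) := by
  rw [isOpen_CwS_iff]
  intro g
  rw [isOpen_iff_mem_nhds]
  rintro σ ⟨hσ, d, hd⟩
  have hc : Continuous fun σ' : CwR => σ' - σ := by fun_prop
  have hm := hc.continuousAt.preimage_mem_nhds (x := σ)
    ((isOpen_small_deriv (d⁻¹).toCwS).mem_nhds (by
      intro t
      simp only [sub_self]
      have : (fun s : ℝ => (0 : CwR) ((d⁻¹).toCwS (Circle.exp s))) = fun _ => 0 := rfl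
      rw [this]
      simp))
  filter_upwards [hm, isOpen_chartTarget.mem_nhds hσ] with σ' h1 h2
  refine ⟨h2, ?_⟩
  let ξ : CwR := ⟨fun z => (σ' - σ) ((d⁻¹).toCwS z),
    (σ' - σ).contMDiff.comp (d⁻¹).toCwS.contMDiff⟩
  obtain ⟨Φ, hΦ⟩ := exists_diffeo ξ h1
  refine ⟨Φ * d, ?_⟩
  ext z
  have e1 : d z = g z * Circle.exp (σ z) := DFunLike.congr_fun hd z
  have e2 : (Φ * d).toCwS z = d z * Circle.exp ((σ' - σ) (d.symm (d z))) := hΦ (d z)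
  rw [e2, d.symm_apply_apply, param_apply, e1, mul_assoc, ← Circle.exp_add]
  congr 4
  change σ z + (σ' z - σ z) = σ' z
  ring

lemma isOpenEmbedding_toCwS : IsOpenEmbedding DiffS.toCwS :=
  ⟨⟨⟨rfl⟩, toCwS_injective⟩, isOpen_range_toCwS⟩

instance : Nonempty DiffS := ⟨1⟩

/-- The restriction to `Diff^ω(S¹)` of the canonical chart centred at `f`. -/
def chartDiffS (f : CwS) : OpenPartialHomeomorph DiffS CwR :=
  (isOpenEmbedding_toCwS.toOpenPartialHomeomorph DiffS.toCwS).trans (chartCwS f)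

lemma mem_chartDiffS_source (f : CwS) (d : DiffS) :
    d ∈ (chartDiffS f).source ↔ d.toCwS ∈ chartSource f := by
  simp [chartDiffS, chartCwS]

lemma chartDiffS_apply (f : CwS) (d : DiffS) : chartDiffS f d = chartFun f d.toCwS := rfl

/-- The canonical charts turn `Diff^ω(S¹)` into an open submanifold of `C^ω(S¹, S¹)`. -/
instance : ChartedSpace CwR DiffS where
  atlas := range chartDiffS
  chartAt d := chartDiffS d.toCwS
  mem_chart_source _ := (mem_chartDiffS_source _ _).2 (self_mem_chartSource _)
  chart_mem_atlas _ := mem_range_self _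

instance : T2Space DiffS := isOpenEmbedding_toCwS.isEmbedding.t2Space

lemma toCwS_chartDiffS_symm {f : CwS} {η : CwR} (h : η ∈ (chartDiffS f).target) :
    ((chartDiffS f).symm η).toCwS = param f η := by
  have h1 := (chartDiffS f).map_target h
  rw [mem_chartDiffS_source] at h1
  rw [← param_chartFun h1, ← chartDiffS_apply, (chartDiffS f).right_inv h]

/-- A map that is locally a translation is real analytic. -/
lemma isRealAnalyticOn_of_translation {f : CwR → CwR} {U : Set CwR} (hU : IsOpen U)
    (h : ∀ x ∈ U, ∃ a, ∀ᶠ y in 𝓝 x, f y = y + a) : IsRealAnalyticOn f U := by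
  have key : ∀ x ∈ U, ∀ᶠ y in 𝓝 x, f y = f x + (y - x) := by
    intro x hx
    obtain ⟨a, ha⟩ := h x hx
    filter_upwards [ha] with y hy
    rw [hy, ha.self_of_nhds]
    abel
  have hfc : ContinuousOn f U := by
    intro x hx
    have : ContinuousAt (fun y => f x + (y - x)) x := by fun_prop
    exact (this.congr ((key x hx).mono fun y hy => hy.symm)).continuousWithinAt
  refine ⟨Prod.fst ⁻¹' U, fun p => (f p.1, p.2), hU.preimage continuous_fst, fun x hx => hx,
    ⟨fun k => match k with
      | 0 => fun p _ => ((f p.1, p.2) : CwR × CwR)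
      | 1 => fun _ y => y 0
      | _ + 2 => fun _ _ => 0, ?_, ?_, ?_⟩, fun x _ => rfl⟩
  · intro x _ y
    rfl
  · intro k
    match k with
    | 0 =>
      refine ContinuousOn.prodMk (f := fun p : Complexification CwR × _ => f p.1.1)
        (g := fun p : Complexification CwR × (Fin 0 → Complexification CwR) => p.1.2) ?_ ?_
      · exact hfc.comp (continuous_fst.comp continuous_fst).continuousOn fun p hp => hp.1
      · exact (continuous_snd.comp continuous_fst).continuousOn
    | 1 => exact ((continuous_apply 0).comp continuous_snd).continuousOn
    | _ + 2 => exact continuousOn_const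
  · intro k x hx y v
    match k with
    | 0 =>
      change Tendsto _ _ (𝓝 v)
      have hc : ContinuousAt (fun t : ℂ => x.1 + (t.re • v.1 - t.im • v.2)) 0 := by
        fun_prop
      have hk := key x.1 hx
      have h0 : x.1 + ((0 : ℂ).re • v.1 - (0 : ℂ).im • v.2) = x.1 := by simp
      rw [← h0] at hk
      have hev := hc.eventually hk
      refine tendsto_const_nhds.congr' ?_
      filter_upwards [nhdsWithin_le_nhds hev, self_mem_nhdsWithin] with t ht ht0
      rw [h0] at ht
      have hd : ((f (x + t • v).1, (x + t • v).2) : CwR × CwR) - ((f x.1, x.2) : CwR × CwR)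
          = (t • v : Complexification CwR) := by
        refine Prod.ext ?_ ?_
        · change f (x.1 + (t.re • v.1 - t.im • v.2)) - f x.1 = t.re • v.1 - t.im • v.2
          rw [ht]
          abel
        · change x.2 + (t • v).2 - x.2 = (t • v).2
          abel
      refine Eq.trans ?_ (congrArg (fun w : Complexification CwR => t⁻¹ • w) hd.symm)
      exact (inv_smul_smul₀ (show t ≠ 0 from ht0) v).symm
    | 1 =>
      simp only [sub_self, smul_zero]
      exact tendsto_const_nhds
    | _ + 2 =>
      simp only [sub_self, smul_zero]
      exact tendsto_const_nhds

/-- `Diff^ω(S¹)` is a real analytic manifold. -/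
theorem isRealAnalyticManifold_DiffS : IsRealAnalyticManifold CwR DiffS where
  t2_model := inferInstance
  t2 := inferInstance
  compatible := by
    rintro _ ⟨g, rfl⟩ _ ⟨f, rfl⟩
    refine isRealAnalyticOn_of_translation
      ((chartDiffS g).isOpen_inter_preimage_symm (chartDiffS f).open_source) ?_
    rintro σ ⟨hσ, hσ'⟩
    rw [mem_preimage, mem_chartDiffS_source, toCwS_chartDiffS_symm hσ] at hσ'
    have hτ := param_chartFun hσ'
    refine ⟨chartFun f (param g σ) - σ, ?_⟩
    have hc : ContinuousAt (fun σ' : CwR => σ' + (chartFun f (param g σ) - σ)) σ := by fun_prop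
    have hm := hc.preimage_mem_nhds (isOpen_chartTarget.mem_nhds (by
      rw [add_sub_cancel]
      exact chartFun_mem hσ'))
    filter_upwards [(chartDiffS g).open_target.mem_nhds hσ, hm] with σ' h1 h2
    rw [Function.comp_apply, chartDiffS_apply, toCwS_chartDiffS_symm h1,
      param_translate hτ.symm σ']
    exact chartFun_param f h2

end AnalyticDiff

end

/-!
Read in the canonical charts centred at the identity, composition is the map
`(η, ξ) ↦ ξ(z) + η(z exp(i ξ(z)))`. If it extended holomorphically to a neighbourhood of `0` in the
complexification of `E × E`, that neighbourhood would contain all pairs `(η, s)` with `η` in a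
neighbourhood `A` of `0` in `E` and `s` a complex constant with `|s| < r`, where `r` does not depend
on `η ∈ A`. Evaluating at `z = 1`, the function `s ↦ η(exp(i s))` of the real variable `s` would thus
extend holomorphically to the disc of radius `r`, for every `η ∈ A`
(`exists_holomorphic_extension`).

This is absurd: whatever `a ∈ (0, 1)` is, a small multiple of the function
`poleFun a : z ↦ Re (1 / (z - a))` belongs to `A`, and for `a = exp(-r/2)` the analytic
continuation of `s ↦ poleFun a (exp(i s))` has a pole at `s = i r/2`
(`no_holomorphic_extension_poleFun`).
-/

open Set Filter Topology
open scoped Manifold ContDiff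

noncomputable section

namespace AnalyticDiff

/-! ### Real analytic functions on the circle with poles close to the circle -/

/-- For `0 < a < 1`, the real analytic function `z ↦ Re (1 / (z - a))` on the circle. -/
def poleFun (a : ℝ) (h0 : 0 < a) (h1 : a < 1) : CwR :=
  ⟨fun z => (((z : ℂ) - a)⁻¹).re, by
    let U : TopologicalSpace.Opens ℂ := ⟨{(a : ℂ)}ᶜ, isOpen_compl_singleton⟩
    have hU : ∀ z : Circle, (z : ℂ) ∈ U := by
      rintro z (hz : (z : ℂ) = a)
      have h := Circle.norm_coe z
      rw [hz, Complex.norm_real, Real.norm_of_nonneg h0.le] at h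
      exact h1.ne h
    have hF : DifferentiableOn ℂ (fun z : ℂ => (z - a)⁻¹) U := fun z hz =>
      ((differentiableAt_fun_id.sub_const (a : ℂ)).fun_inv (sub_ne_zero.2 hz)).differentiableWithinAt
    exact Complex.reCLM.contDiff.contMDiff.comp (contMDiff_restrict hU hF)⟩

/-- On the circle, `2 Re (1 / (z - a)) = 1 / (z - a) + 1 / (z⁻¹ - a)`, with denominators cleared. -/
lemma poleFun_exp_mul {a : ℝ} (h0 : 0 < a) (h1 : a < 1) (x : ℝ) :
    (poleFun a h0 h1 (Circle.exp x) : ℂ) *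
        ((Complex.exp (x * Complex.I) - a) * (Complex.exp (-(x * Complex.I)) - a))
      = (Complex.exp (x * Complex.I) + Complex.exp (-(x * Complex.I)) - 2 * a) / 2 := by
  have hconj : (starRingEnd ℂ) (Complex.exp (x * Complex.I)) = Complex.exp (-(x * Complex.I)) := by
    rw [← Complex.exp_conj]
    simp
  have hne : Complex.exp (x * Complex.I) - a ≠ 0 := by
    intro h
    have h2 := Complex.norm_exp_ofReal_mul_I x
    rw [sub_eq_zero.1 h, Complex.norm_real, Real.norm_of_nonneg h0.le] at h2
    exact h1.ne h2
  have hne' : Complex.exp (-(x * Complex.I)) - a ≠ 0 := by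
    rw [← hconj, ← Complex.conj_ofReal a, ← map_sub]
    exact (map_ne_zero _).2 hne
  have hval : (poleFun a h0 h1 (Circle.exp x) : ℂ)
      = ((Complex.exp (x * Complex.I) - a)⁻¹ + (Complex.exp (-(x * Complex.I)) - a)⁻¹) / 2 := by
    change (((((Circle.exp x : Circle) : ℂ) - a)⁻¹).re : ℂ) = _
    rw [Complex.re_eq_add_conj, Circle.coe_exp, map_inv₀, map_sub, hconj, Complex.conj_ofReal]
  rw [hval]
  field_simp
  ring

/-- For `a = exp (-r/2)` and `t ≠ 0`, the function `x ↦ x + t * poleFun a (exp (i x))` on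
`(-r, r)` has no holomorphic extension to the disc of radius `r`. -/
lemma no_holomorphic_extension_poleFun {r a : ℝ} (hr : 0 < r) (ha : a = Real.exp (-(r / 2)))
    (h0 : 0 < a) (h1 : a < 1) {t : ℝ} (ht : t ≠ 0) (H : ℂ → ℂ)
    (hH : DifferentiableOn ℂ H (Metric.ball 0 r))
    (hHr : ∀ x : ℝ, |x| < r → H x = x + t * poleFun a h0 h1 (Circle.exp x)) : False := by
  let P : ℂ → ℂ := fun s =>
    (Complex.exp (s * Complex.I) - a) * (Complex.exp (-(s * Complex.I)) - a)
  let Q : ℂ → ℂ := fun s =>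
    (Complex.exp (s * Complex.I) + Complex.exp (-(s * Complex.I)) - 2 * a) / 2
  have hP : Differentiable ℂ P := by fun_prop
  have hQ : Differentiable ℂ Q := by fun_prop
  have hL : AnalyticOnNhd ℂ (fun s => H s * P s) (Metric.ball 0 r) :=
    (hH.mul hP.differentiableOn).analyticOnNhd Metric.isOpen_ball
  have hR : AnalyticOnNhd ℂ (fun s => s * P s + t * Q s) (Metric.ball 0 r) :=
    DifferentiableOn.analyticOnNhd
      (((differentiable_id.mul hP).add (hQ.const_mul _)).differentiableOn) Metric.isOpen_ball
  have hreal : ∀ x : ℝ, |x| < r → H x * P x = x * P x + t * Q x := by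
    intro x hx
    rw [hHr x hx, add_mul, mul_assoc, poleFun_exp_mul]
  have hfreq : ∃ᶠ s : ℂ in 𝓝[≠] 0, H s * P s = s * P s + t * Q s := by
    have hlim : Tendsto (fun x : ℝ => (x : ℂ)) (𝓝[≠] 0) (𝓝[≠] 0) := by
      refine tendsto_nhdsWithin_iff.2 ⟨?_, ?_⟩
      · exact (Complex.continuous_ofReal.tendsto' 0 0 Complex.ofReal_zero).mono_left
          nhdsWithin_le_nhds
      · filter_upwards [self_mem_nhdsWithin] with x hx
        exact Complex.ofReal_ne_zero.2 hx
    refine hlim.frequently (Eventually.frequently ?_)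
    filter_upwards [nhdsWithin_le_nhds (Metric.ball_mem_nhds (0 : ℝ) hr)] with x hx
    exact hreal x (by simpa using hx)
  have heq := hL.eqOn_of_preconnected_of_frequently_eq hR
    (convex_ball (0 : ℂ) r).isPreconnected (Metric.mem_ball_self hr) hfreq
  -- the point `i r/2`, where `exp (i s) = a`
  have hmem : ((r / 2 : ℝ) : ℂ) * Complex.I ∈ Metric.ball (0 : ℂ) r := by
    rw [mem_ball_zero_iff, norm_mul, Complex.norm_I, mul_one, Complex.norm_real,
      Real.norm_of_nonneg (by positivity)]
    linarith
  have hs : ((r / 2 : ℝ) : ℂ) * Complex.I * Complex.I = ((-(r / 2) : ℝ) : ℂ) := by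
    rw [mul_assoc, Complex.I_mul_I]
    push_cast
    ring
  have hexp : Complex.exp (((r / 2 : ℝ) : ℂ) * Complex.I * Complex.I) = (a : ℂ) := by
    rw [hs, ← Complex.ofReal_exp, ← ha]
  have hexp' : Complex.exp (-(((r / 2 : ℝ) : ℂ) * Complex.I * Complex.I)) = (a : ℂ)⁻¹ := by
    rw [Complex.exp_neg, hexp]
  have h := heq hmem
  simp only [P, Q, hexp, hexp', sub_self, zero_mul, mul_zero, zero_add] at h
  have h2 : t * ((a + a⁻¹ - 2 * a) / 2) = 0 := by exact_mod_cast h.symm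
  have h3 : 1 < a⁻¹ := (one_lt_inv₀ h0).2 h1
  rcases mul_eq_zero.1 h2 with h4 | h4
  · exact ht h4
  · linarith

/-! ### Composition in the canonical chart at the identity -/

/-- The identity, as an element of `C^ω(S¹, S¹)`. -/
def idCwS : CwS := (1 : DiffS).toCwS

/-- The constant function `1`. -/
def oneCwR : CwR := ⟨fun _ => 1, contMDiff_const⟩

lemma smul_apply (c : ℝ) (η : CwR) (z : Circle) : (c • η) z = c * η z := rfl

lemma smul_oneCwR_apply (c : ℝ) (z : Circle) : (c • oneCwR) z = c := mul_one c

lemma zero_mem_target : (0 : CwR) ∈ (chartDiffS idCwS).target := by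
  have h : chartDiffS idCwS 1 = 0 := by
    ext z
    have h1 := chartFun_apply (self_mem_chartSource idCwS) z
    rw [div_self', Circle.coe_one, Complex.arg_one] at h1
    exact h1
  rw [← h]
  exact (chartDiffS idCwS).map_source
    ((mem_chartDiffS_source _ _).2 (self_mem_chartSource _))

lemma chartDiffS_symm_zero : (chartDiffS idCwS).symm 0 = 1 := by
  refine toCwS_injective ?_
  rw [toCwS_chartDiffS_symm zero_mem_target]
  ext z
  change ((idCwS z * Circle.exp (0 : ℝ) : Circle) : ℂ) = idCwS z
  rw [Circle.exp_zero, mul_one]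

/-- In the chart at the identity, composition with the rotation by the angle `x` is
`η ↦ x + η (· exp (i x))`; here at the point `1`. -/
lemma chart_mul_rotation {η : CwR} {x : ℝ} (hη : η ∈ (chartDiffS idCwS).target)
    (hx : x • oneCwR ∈ (chartDiffS idCwS).target)
    (hmem : (chartDiffS idCwS).symm η * (chartDiffS idCwS).symm (x • oneCwR)
      ∈ (chartDiffS idCwS).source)
    (hη' : |η (Circle.exp x)| < Real.pi / 2) (hx' : |x| < Real.pi / 2) :
    chartDiffS idCwS ((chartDiffS idCwS).symm η * (chartDiffS idCwS).symm (x • oneCwR)) 1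
      = x + η (Circle.exp x) := by
  have e1 : ∀ z, (chartDiffS idCwS).symm η z = z * Circle.exp (η z) := fun z =>
    DFunLike.congr_fun (toCwS_chartDiffS_symm hη) z
  have e2 : (chartDiffS idCwS).symm (x • oneCwR) 1 = Circle.exp x := by
    refine (DFunLike.congr_fun (toCwS_chartDiffS_symm hx) 1).trans ?_
    rw [param_apply, smul_oneCwR_apply]
    exact one_mul _
  rw [mem_chartDiffS_source] at hmem
  rw [chartDiffS_apply, chartFun_apply hmem]
  change Complex.arg (((chartDiffS idCwS).symm η ((chartDiffS idCwS).symm (x • oneCwR) 1)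
    / (1 : Circle) : Circle) : ℂ) = _
  rw [e2, e1, div_one, ← Circle.exp_add]
  have h1 := abs_lt.1 hη'
  have h2 := abs_lt.1 hx'
  exact Circle.arg_exp (by linarith) (by linarith)

/-! ### Holomorphic maps along complex lines -/

/-- The complex-valued evaluation at `1` on the complexification of `CwR`. -/
def evalOne (p : Complexification CwR) : ℂ := (p.1 1 : ℂ) + (p.2 1 : ℂ) * Complex.I

lemma evalOne_sub (p q : Complexification CwR) : evalOne (p - q) = evalOne p - evalOne q := by
  change (((p.1 1 - q.1 1 : ℝ) : ℂ)) + ((p.2 1 - q.2 1 : ℝ) : ℂ) * Complex.I = _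
  unfold evalOne
  push_cast
  ring

lemma evalOne_smul (c : ℂ) (p : Complexification CwR) : evalOne (c • p) = c * evalOne p := by
  change (((c.re * p.1 1 - c.im * p.2 1 : ℝ) : ℂ))
    + ((c.im * p.1 1 + c.re * p.2 1 : ℝ) : ℂ) * Complex.I = _
  unfold evalOne
  conv_rhs => rw [← Complex.re_add_im c]
  push_cast
  linear_combination (-(c.im : ℂ) * (p.2 1 : ℂ)) * Complex.I_sq

lemma continuous_evalOne : Continuous evalOne := by
  have h := continuous_eval 1
  exact (Complex.continuous_ofReal.comp (h.comp continuous_fst)).add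
    ((Complex.continuous_ofReal.comp (h.comp continuous_snd)).mul continuous_const)

lemma differentiableAt_evalOne_line {X : Type*} [AddCommGroup X] [Module ℂ X] [TopologicalSpace X]
    {g : X → Complexification CwR} {V : Set X} (hV : IsOpen V) (hg : IsKellerSmoothOn ℂ g V)
    {L : ℂ → X} (hL : Continuous L) {v : X} (hLv : ∀ s u : ℂ, L (s + u) = L s + u • v)
    {s : ℂ} (hs : L s ∈ V) : DifferentiableAt ℂ (fun s => evalOne (g (L s))) s := by
  obtain ⟨d, hd0, -, hd⟩ := hg
  let y : Fin 0 → X := Fin.elim0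
  have h := (continuous_evalOne.tendsto _).comp (hd 0 (L s) hs y v)
  refine (hasDerivAt_iff_tendsto_slope_zero.2 (h.congr' ?_)).differentiableAt
  have hc : ContinuousAt (fun u : ℂ => L (s + u)) 0 := by fun_prop
  have hev : ∀ᶠ u : ℂ in 𝓝 0, L (s + u) ∈ V :=
    hc.preimage_mem_nhds (hV.mem_nhds (by simpa using hs))
  filter_upwards [nhdsWithin_le_nhds hev] with u hu
  rw [Function.comp_apply, evalOne_smul, evalOne_sub, hd0 _ hs, ← hLv, hd0 _ hu, smul_eq_mul]

/-- If composition is real analytic, there are a neighbourhood `A` of zero and a radius `r`,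
independent of `η ∈ A`, such that `x ↦ x + η (exp (i x))` extends holomorphically to the disc of
radius `r`. -/
lemma exists_holomorphic_extension
    (h : IsRealAnalyticMap (CwR × CwR) CwR (fun p : DiffS × DiffS => p.1 * p.2)) :
    ∃ A ∈ 𝓝 (0 : CwR), ∃ r > 0, ∀ η ∈ A, ∃ H : ℂ → ℂ,
      DifferentiableOn ℂ H (Metric.ball 0 r) ∧
        ∀ x : ℝ, |x| < r → H x = x + η (Circle.exp x) := by
  let e : OpenPartialHomeomorph DiffS CwR := chartDiffS idCwS
  have he : e ∈ atlas CwR DiffS := mem_range_self _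
  obtain ⟨V, g, hV, hUV, hg, hgf⟩ := h.analytic (e.prod e) ⟨e, he, e, he, rfl⟩ e he
  have hopen := h.continuous.isOpen_preimage _ e.open_source
  have hUo := (e.prod e).isOpen_inter_preimage_symm hopen
  set U := (e.prod e).target ∩ (e.prod e).symm ⁻¹'
    ((fun p : DiffS × DiffS => p.1 * p.2) ⁻¹' e.source) with hU
  have h0U : ((0 : CwR), (0 : CwR)) ∈ U := by
    refine ⟨⟨zero_mem_target, zero_mem_target⟩, ?_⟩
    change (chartDiffS idCwS).symm 0 * (chartDiffS idCwS).symm 0 ∈ (chartDiffS idCwS).source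
    rw [chartDiffS_symm_zero, mul_one]
    exact (mem_chartDiffS_source _ _).2 (self_mem_chartSource _)
  -- the point `η + i 0` in the first component, the complex constant `s` in the second one
  let L : CwR → ℂ → Complexification (CwR × CwR) := fun η s =>
    (((η, s.re • oneCwR), ((0 : CwR), s.im • oneCwR)) : (CwR × CwR) × (CwR × CwR))
  have hL : Continuous fun p : CwR × ℂ => L p.1 p.2 := by
    change Continuous fun p : CwR × ℂ =>
      (((p.1, p.2.re • oneCwR), ((0 : CwR), p.2.im • oneCwR)) : (CwR × CwR) × (CwR × CwR))
    fun_prop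
  have hL0 : L 0 0 = Complexification.ofReal ((0 : CwR), (0 : CwR)) := by
    change ((((0 : CwR), (0 : ℝ) • oneCwR), ((0 : CwR), (0 : ℝ) • oneCwR)) :
      (CwR × CwR) × (CwR × CwR)) = ((0, 0), 0)
    rw [zero_smul]
    rfl
  have n1 : ∀ᶠ p : CwR × ℂ in 𝓝 (0, 0), L p.1 p.2 ∈ V :=
    hL.continuousAt.preimage_mem_nhds (hV.mem_nhds (by
      change L 0 0 ∈ V
      rw [hL0]
      exact hUV _ h0U))
  have n2 : ∀ᶠ p : CwR × ℂ in 𝓝 (0, 0), (p.1, p.2.re • oneCwR) ∈ U := by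
    have hc : Continuous fun p : CwR × ℂ => (p.1, p.2.re • oneCwR) := by fun_prop
    exact hc.continuousAt.preimage_mem_nhds (hUo.mem_nhds (by simpa using h0U))
  have n3 : ∀ᶠ p : CwR × ℂ in 𝓝 (0, 0), (2 : ℝ) • p.1 ∈ chartTarget := by
    have hc : Continuous fun p : CwR × ℂ => (2 : ℝ) • p.1 := by fun_prop
    refine hc.continuousAt.preimage_mem_nhds (isOpen_chartTarget.mem_nhds ?_)
    intro z
    simp only [smul_zero]
    change |(0 : ℝ)| < _
    rw [abs_zero]
    exact Real.pi_pos
  have n4 : ∀ᶠ p : CwR × ℂ in 𝓝 (0, 0), |p.2.re| < Real.pi / 2 := by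
    have hc : Continuous fun p : CwR × ℂ => |p.2.re| := by fun_prop
    exact hc.continuousAt.eventually_lt_const (by simpa using Real.pi_pos)
  obtain ⟨A, hA, B, hB, hAB⟩ := mem_nhds_prod_iff.1 (n1.and (n2.and (n3.and n4)))
  obtain ⟨r, hr, hrB⟩ := Metric.mem_nhds_iff.1 hB
  refine ⟨A, hA, r, hr, fun η hη => ⟨fun s => evalOne (g (L η s)), fun s hs => ?_, fun x hx => ?_⟩⟩
  · let v : Complexification (CwR × CwR) :=
      ((((0 : CwR), oneCwR), ((0 : CwR), (0 : CwR))) : (CwR × CwR) × (CwR × CwR))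
    refine (differentiableAt_evalOne_line hV hg (L := L η) (v := v)
      (hL.comp (Continuous.prodMk_right η)) (fun s u => ?_)
      (hAB (mk_mem_prod hη (hrB hs))).1).differentiableWithinAt
    refine Prod.ext (Prod.ext ?_ ?_) (Prod.ext ?_ ?_)
    · change η = η + (u.re • (0 : CwR) - u.im • (0 : CwR))
      simp
    · change (s.re + u.re) • oneCwR = s.re • oneCwR + (u.re • oneCwR - u.im • (0 : CwR))
      rw [smul_zero, sub_zero, add_smul]
    · change (0 : CwR) = 0 + (u.im • (0 : CwR) + u.re • (0 : CwR))
      simp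
    · change (s.im + u.im) • oneCwR = s.im • oneCwR + (u.im • oneCwR + u.re • (0 : CwR))
      rw [smul_zero, add_zero, add_smul]
  · have hxB : (x : ℂ) ∈ B := hrB (by simpa using hx)
    obtain ⟨-, m2, m3, m4⟩ := hAB (mk_mem_prod hη hxB)
    simp only [Complex.ofReal_re] at m2 m3 m4
    have hLx : L η x = Complexification.ofReal (η, x • oneCwR) := by
      change (((η, x • oneCwR), ((0 : CwR), (0 : ℝ) • oneCwR)) : (CwR × CwR) × (CwR × CwR))
        = ((η, x • oneCwR), 0)
      rw [zero_smul]
      rfl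
    have hη' : |η (Circle.exp x)| < Real.pi / 2 := by
      have h2 := m3 (Circle.exp x)
      rw [smul_apply, abs_mul, abs_two] at h2
      linarith
    have hval := chart_mul_rotation m2.1.1 m2.1.2 m2.2 hη' m4
    change evalOne (g (L η x)) = _
    rw [hLx, hgf _ m2]
    change ((chartDiffS idCwS ((chartDiffS idCwS).symm η *
      (chartDiffS idCwS).symm (x • oneCwR)) 1 : ℝ) : ℂ) + ((0 : ℝ) : ℂ) * Complex.I = _
    rw [hval]
    push_cast
    ring

theorem not_isRealAnalyticMap_mul :
    ¬ IsRealAnalyticMap (CwR × CwR) CwR (fun p : DiffS × DiffS => p.1 * p.2) := by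
  intro h
  obtain ⟨A, hA, r, hr, hext⟩ := exists_holomorphic_extension h
  have h0 : 0 < Real.exp (-(r / 2)) := Real.exp_pos _
  have h1 : Real.exp (-(r / 2)) < 1 := Real.exp_lt_one_iff.2 (by linarith)
  have hc : Continuous fun t : ℝ => t • poleFun _ h0 h1 := by fun_prop
  have hev : ∀ᶠ t : ℝ in 𝓝[≠] 0, t • poleFun _ h0 h1 ∈ A :=
    nhdsWithin_le_nhds (hc.continuousAt.preimage_mem_nhds (by simpa using hA))
  obtain ⟨t, htA, ht⟩ := (hev.and self_mem_nhdsWithin).exists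
  obtain ⟨H, hH, hHx⟩ := hext _ htA
  refine no_holomorphic_extension_poleFun hr rfl h0 h1 ht H hH fun x hx => ?_
  rw [hHx x hx, smul_apply]
  push_cast
  rfl

end AnalyticDiff

end

/-- Composition on `Diff^ω(S¹)` is not real analytic, and hence `Diff^ω(S¹)` is not a real
analytic Lie group. -/
theorem theoremC :
    ¬ AnalyticDiff.IsRealAnalyticMap (AnalyticDiff.CwR × AnalyticDiff.CwR) AnalyticDiff.CwR
        (fun p : AnalyticDiff.DiffS × AnalyticDiff.DiffS => p.1 * p.2) ∧
      ¬ AnalyticDiff.IsRealAnalyticLieGroup AnalyticDiff.CwR AnalyticDiff.DiffS :=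
  ⟨AnalyticDiff.not_isRealAnalyticMap_mul, fun h => AnalyticDiff.not_isRealAnalyticMap_mul h.mul⟩
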